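/- Let $X$ be a finite simplicial complex. For $i\ge 0$ let $X(i)$ be the set of its $i$-dimensional faces, let $C^i(X)=C^i(X;\mathbb{Z}_2)$ be the space of $\mathbb{Z}_2$-valued functions on $X(i)$, and let $d_i:C^i(X)\to C^{i+1}(X)$ be the usual coboundary operator. For $i=-1$ one may use either the non-reduced convention ($C^{-1}(X)=0$) or the reduced convention ($X(-1)=\{\emptyset\}$, $C^{-1}(X)=\mathbb{Z}_2$, and $d_{-1}$ sends $1$ to the all-ones function on the vertices). For a cochain $\phi\in C^i(X)$ let $\|\phi\|$ be the number of $i$-faces on which $\phi$ is nonzero, and for $\phi\in C^k(X)$, $k\ge 0$, put $$\|\phi\|_{\mathrm{csy}}=\min_{\psi\in C^{k-1}(X)}\|\phi+d_{k-1}\psi\|.$$ The $k$-th Cheeger constant of $X$ is $$h^k(X)=\min\left\{\frac{\|d_k\phi\|}{\|\phi\|_{\mathrm{csy}}}:\ \phi\in C^k(X)\setminus d_{k-1}C^{k-1}(X)\right\}.$$ Let $k\ge 0$ and $D$ be integers and let $X$ be a (non-empty) finite pure $(k+1)$-dimensional simplicial complex, i.e. every face is contained in a $(k+1)$-dimensional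 face and there are no faces of larger dimension. Suppose that every $k$-dimensional face of $X$ is contained in exactly $D$ faces of dimension $k+1$, and that $D\ge 40^2(k+1)$. Then $C^k(X)\setminus d_{k-1}C^{k-1}(X)\neq\emptyset$, so that $h^k(X)$ is defined, and $$h^k(X)\ \le\ \left(1+\frac{50\sqrt{k+1}}{\sqrt{D}}\right)\cdot\frac{D}{k+2}.$$ This holds in both the non-reduced and the reduced convention (they differ only for $k=0$). -/

import Mathlib

namespace CoboundaryExpansion

variable {V : Type*} [Fintype V]

open Classical in
/-- The members of the family `F` with exactly `m` vertices, that is, its `(m - 1)`-dimensional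
faces. -/
noncomputable def cells (F : Set (Finset V)) (m : ℕ) : Finset (Finset V) :=
  Finset.univ.filter fun s => s ∈ F ∧ s.card = m

/-- `𝔽₂`-valued cochains of dimension `m - 1` (functions on the faces with `m` vertices). -/
abbrev Cochain (F : Set (Finset V)) (m : ℕ) : Type _ := cells F m → ZMod 2

open Classical in
/-- The coboundary operator over `𝔽₂` from dimension `m - 1` to dimension `m`: the value at `τ` is
the sum of the values at the facets of `τ`. -/
noncomputable def coboundary (F : Set (Finset V)) (m : ℕ) :
    Cochain F m →ₗ[ZMod 2] Cochain F (m + 1) where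
  toFun φ := fun τ => ∑ σ : cells F m with σ.1 ⊆ τ.1, φ σ
  map_add' φ ψ := by
    funext τ
    simp [Finset.sum_add_distrib]
  map_smul' a φ := by
    funext τ
    simp [Finset.mul_sum]

/-- The norm of a cochain: the size of its support. -/
noncomputable def cnorm {F : Set (Finset V)} {m : ℕ} (φ : Cochain F m) : ℕ :=
  (Function.support φ).ncard

/-- The cosystolic norm of a `k`-cochain `φ` (faces of dimension `k` have `k + 1` vertices):
the minimum of the norms of `φ + d ψ` over all `(k - 1)`-cochains `ψ`. -/
noncomputable def csyNorm {F : Set (Finset V)} {k : ℕ} (φ : Cochain F (k + 1)) : ℕ :=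
  ⨅ ψ : Cochain F k, cnorm (φ + coboundary F k ψ)

/-- The coboundary expansions `‖d φ‖ / ‖φ‖_csy` of all `k`-cochains `φ` that are not
coboundaries. -/
def expansions (F : Set (Finset V)) (k : ℕ) : Set ℝ :=
  {x | ∃ φ : Cochain F (k + 1), φ ∉ LinearMap.range (coboundary F k) ∧
    x = (cnorm (coboundary F (k + 1) φ) : ℝ) / (csyNorm φ : ℝ)}

/-- The `k`-th Cheeger constant of a finite simplicial complex, with non-reduced cochains:
since the empty set is not a member of `X.faces`, there are no nonzero `(-1)`-cochains. -/
noncomputable def cheeger (X : PreAbstractSimplicialComplex V) (k : ℕ) : ℝ :=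
  sInf (expansions X.faces k)

/-- The `k`-th Cheeger constant with reduced (augmented) cochains: the empty simplex is the unique
face of dimension `-1`. It differs from `cheeger X k` only for `k = 0`. -/
noncomputable def reducedCheeger (X : PreAbstractSimplicialComplex V) (k : ℕ) : ℝ :=
  sInf (expansions (insert ∅ X.faces) k)

/-- `X` is nonempty and each of its faces lies in a face of dimension `d`, while no face has larger
dimension. -/
def IsPure (X : PreAbstractSimplicialComplex V) (d : ℕ) : Prop :=
  X.faces.Nonempty ∧ (∀ s ∈ X.faces, s.card ≤ d + 1) ∧
    ∀ s ∈ X.faces, ∃ t ∈ X.faces, s ⊆ t ∧ t.card = d + 1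

/-- The degree of a face: the number of faces with one more vertex that contain it. -/
noncomputable def degree (X : PreAbstractSimplicialComplex V) (s : Finset V) : ℕ :=
  {t ∈ X.faces | s ⊆ t ∧ t.card = s.card + 1}.ncard

end CoboundaryExpansion

/-
Choose a `k`-cochain `φ` uniformly at random. Distinct `(k + 1)`-faces have distinct sets of facets,
so the coordinates of `d φ` are uniform and pairwise independent, and by Chebyshev's inequality
`‖d φ‖` is, with probability at least `1 / 2`, not much larger than half the number of
`(k + 1)`-faces. By Chernoff's inequality a Hamming ball of radius slightly less than half the
number `n` of `k`-faces has exponentially small density, and the space of coboundaries is small: its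
dimension is at most the number of facets of `k`-faces, and this number is at most `(k + 1) n / D`,
since a facet of a `k`-face lies in at least as many `k`-faces as the `k`-face lies in
`(k + 1)`-faces. Hence the balls around all the coboundaries cover less than half of the cochains,
and some `φ` is good in both respects. With `s = √((k + 1) / D)`, a relative deviation of `2 * s`
from the mean suffices in both estimates, and the ratio is at most `(1 + 2 * s) / (1 - 2 * s)` times
`D / (k + 2)`.
-/

open Finset Module
open scoped FinsetFamily Pointwise

namespace CoboundaryExpansion

section RandomVectors

lemma card_filter_nsmul_le_sum {α M : Type*} [Fintype α] [AddCommMonoid M] [PartialOrder M]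
    [IsOrderedAddMonoid M] {p : α → Prop} [DecidablePred p] {f : α → M} {c : M}
    (hf : ∀ a, 0 ≤ f a) (hc : ∀ a, p a → c ≤ f a) : #{a | p a} • c ≤ ∑ a, f a :=
  (card_nsmul_le_sum _ f c fun a ha ↦ hc a (mem_filter.1 ha).2).trans <|
    sum_le_sum_of_subset_of_nonneg (subset_univ _) fun a _ _ ↦ hf a

/-- The nontrivial character `x ↦ (-1) ^ x` of `𝔽₂`, used to linearize the Hamming norm. -/
noncomputable def sgn : AddChar (ZMod 2) ℝ :=
  AddChar.zmodChar 2 (by norm_num : (-1 : ℝ) ^ 2 = 1)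

lemma sgn_one : sgn 1 = -1 := by
  simp [sgn, AddChar.zmodChar_apply, ZMod.val_one]

lemma sgn_eq_one_sub_two_mul_ite (x : ZMod 2) : sgn x = 1 - 2 * if x ≠ 0 then 1 else 0 := by
  obtain rfl | rfl : x = 0 ∨ x = 1 := by revert x; decide
  · simp
  · rw [sgn_one, if_pos one_ne_zero]
    norm_num

lemma sum_sgn {ι : Type*} [Fintype ι] (φ : ι → ZMod 2) :
    ∑ i, sgn (φ i) = Fintype.card ι - 2 * (hammingNorm φ : ℝ) := by
  simp only [sgn_eq_one_sub_two_mul_ite, sum_sub_distrib, ← mul_sum, sum_boole, hammingNorm,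
    sum_const, card_univ, nsmul_eq_mul, mul_one]

lemma sum_exp_mul_sum_sgn {ι : Type*} [Fintype ι] [DecidableEq ι] (a : ℝ) :
    ∑ φ : ι → ZMod 2, Real.exp (a * ∑ i, sgn (φ i)) = (2 * Real.cosh a) ^ Fintype.card ι := by
  have h_coord : ∑ x : ZMod 2, Real.exp (a * sgn x) = 2 * Real.cosh a := by
    rw [show (univ : Finset (ZMod 2)) = {0, 1} from rfl, sum_pair zero_ne_one,
      AddChar.map_zero_eq_one, sgn_one, Real.cosh_eq]
    ring_nf
  simp only [mul_sum, Real.exp_sum]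
  rw [← Fintype.prod_sum fun (_ : ι) x ↦ Real.exp (a * sgn x), prod_const, h_coord, card_univ]

lemma card_hammingNorm_lt_le {ι : Type*} [Fintype ι] [DecidableEq ι] {ε : ℝ} (hε : 0 ≤ ε) :
    (#{φ : ι → ZMod 2 | (hammingNorm φ : ℝ) < (1 - ε) * Fintype.card ι / 2} : ℝ) ≤
      2 ^ Fintype.card ι * Real.exp (-(ε ^ 2 * Fintype.card ι / 2)) := by
  set n := Fintype.card ι
  set B : Finset (ι → ZMod 2) := {φ | (hammingNorm φ : ℝ) < (1 - ε) * n / 2}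
  have h_markov : #B * Real.exp (ε * (ε * n)) ≤
      ∑ φ : ι → ZMod 2, Real.exp (ε * ∑ i, sgn (φ i)) := by
    rw [← nsmul_eq_mul]
    refine card_filter_nsmul_le_sum (fun φ ↦ (Real.exp_pos _).le) fun φ hφ ↦ ?_
    gcongr
    rw [sum_sgn]
    linarith
  refine le_of_mul_le_mul_right ?_ (Real.exp_pos (ε * (ε * n)))
  calc #B * Real.exp (ε * (ε * n)) ≤ (2 * Real.cosh ε) ^ n :=
        h_markov.trans_eq (sum_exp_mul_sum_sgn ε)
    _ ≤ (2 * Real.exp (ε ^ 2 / 2)) ^ n := by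
        gcongr
        exact Real.cosh_le_exp_half_sq ε
    _ = 2 ^ n * Real.exp (-(ε ^ 2 * n / 2)) * Real.exp (ε * (ε * n)) := by
        rw [mul_pow, ← Real.exp_nat_mul, mul_assoc, ← Real.exp_add]
        ring_nf

variable {G κ : Type*} [AddCommGroup G] [Fintype G] [Fintype κ]

lemma sum_sgn_mul_sgn_eq_zero {f g : G →+ ZMod 2} (hfg : f ≠ g) :
    ∑ x, sgn (f x) * sgn (g x) = 0 := by
  have h_ne : sgn.compAddMonoidHom (f + g) ≠ 0 := fun h ↦ hfg <| by
    ext x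
    have hx : sgn (f x + g x) = 1 := DFunLike.congr_fun h x
    rw [sgn_eq_one_sub_two_mul_ite] at hx
    by_contra hne
    rw [if_pos fun h0 ↦ hne (CharTwo.add_eq_zero.1 h0)] at hx
    norm_num at hx
  simpa [AddChar.map_add_eq_mul] using AddChar.sum_eq_zero_iff_ne_zero.2 h_ne

lemma sum_sq_sum_sgn {T : G →+ κ → ZMod 2} (hT : Pairwise fun i j ↦ ∃ x, T x i ≠ T x j) :
    ∑ x, (∑ j, sgn (T x j)) ^ 2 = (Fintype.card G : ℝ) * Fintype.card κ := by
  classical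
  have h_orth (i j : κ) :
      ∑ x, sgn (T x i) * sgn (T x j) = if i = j then (Fintype.card G : ℝ) else 0 := by
    split_ifs with hij
    · simp [hij, ← AddChar.map_add_eq_mul, CharTwo.add_self_eq_zero]
    · obtain ⟨x, hx⟩ := hT hij
      exact sum_sgn_mul_sgn_eq_zero (f := (Pi.evalAddMonoidHom _ i).comp T)
        (g := (Pi.evalAddMonoidHom _ j).comp T) fun h ↦ hx (DFunLike.congr_fun h x)
  calc ∑ x, (∑ j, sgn (T x j)) ^ 2 = ∑ i, ∑ j, ∑ x, sgn (T x i) * sgn (T x j) := by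
        simp only [sq, sum_mul_sum]
        rw [sum_comm]
        exact sum_congr rfl fun i _ ↦ sum_comm
    _ = Fintype.card G * Fintype.card κ := by simp [h_orth, mul_comm]

lemma card_lt_hammingNorm_mul_le {T : G →+ κ → ZMod 2}
    (hT : Pairwise fun i j ↦ ∃ x, T x i ≠ T x j) {δ : ℝ} (hδ : 0 ≤ δ) :
    (#{x | (1 + δ) * Fintype.card κ / 2 < (hammingNorm (T x) : ℝ)} : ℝ) *
      (δ * Fintype.card κ) ^ 2 ≤ Fintype.card G * Fintype.card κ := by
  rw [← sum_sq_sum_sgn hT, ← nsmul_eq_mul]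
  refine card_filter_nsmul_le_sum (fun x ↦ sq_nonneg _) fun x hx ↦ ?_
  rw [← neg_sq (∑ j, sgn (T x j)), sum_sgn]
  gcongr
  linarith

lemma two_mul_card_lt_hammingNorm_le {T : G →+ κ → ZMod 2}
    (hT : Pairwise fun i j ↦ ∃ x, T x i ≠ T x j) {δ : ℝ} (hδ : 0 ≤ δ)
    (hκ : 2 ≤ δ ^ 2 * Fintype.card κ) :
    2 * (#{x | (1 + δ) * Fintype.card κ / 2 < (hammingNorm (T x) : ℝ)} : ℝ) ≤ Fintype.card G := by
  set N := Fintype.card κ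
  set b := #{x | (1 + δ) * N / 2 < (hammingNorm (T x) : ℝ)}
  have hN : (0 : ℝ) < N := pos_of_mul_pos_right (two_pos.trans_le hκ) (sq_nonneg δ)
  refine le_of_mul_le_mul_right ?_ hN
  calc 2 * (b : ℝ) * N ≤ (δ ^ 2 * N) * b * N := by gcongr
    _ = b * (δ * N) ^ 2 := by ring
    _ ≤ Fintype.card G * N := card_lt_hammingNorm_mul_le hT hδ

lemma card_sub_submodule_le {M : Type*} [AddCommGroup M] [Module (ZMod 2) M] [Finite M]
    [DecidableEq M] (A : Finset M) (W : Submodule (ZMod 2) M) [Fintype (W : Set M)] :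
    #(A - (W : Set M).toFinset) ≤ #A * 2 ^ finrank (ZMod 2) W := by
  have h_card : #(W : Set M).toFinset = 2 ^ finrank (ZMod 2) W := by
    rw [Set.toFinset_card, ← Nat.card_eq_fintype_card]
    exact Module.natCard_eq_pow_finrank.trans (congrArg (· ^ _) (Nat.card_zmod 2))
  exact h_card ▸ card_sub_le

lemma exists_hammingNorm_le_and_forall_le_hammingNorm_add {ι : Type*} [Fintype ι]
    (W : Submodule (ZMod 2) (ι → ZMod 2)) {T : (ι → ZMod 2) →+ κ → ZMod 2}
    (hT : Pairwise fun i j ↦ ∃ φ, T φ i ≠ T φ j) {ε δ : ℝ} (hε : 0 ≤ ε) (hδ : 0 ≤ δ)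
    (hW : 2 ^ finrank (ZMod 2) W * Real.exp (-(ε ^ 2 * Fintype.card ι / 2)) < 1 / 2)
    (hκ : 2 ≤ δ ^ 2 * Fintype.card κ) :
    ∃ φ, (hammingNorm (T φ) : ℝ) ≤ (1 + δ) * Fintype.card κ / 2 ∧
      ∀ w ∈ W, (1 - ε) * Fintype.card ι / 2 ≤ hammingNorm (φ + w) := by
  classical
  set n := Fintype.card ι
  have h_card : Fintype.card (ι → ZMod 2) = 2 ^ n := by simp [n, ZMod.card]
  let A : Finset (ι → ZMod 2) := {φ | (hammingNorm φ : ℝ) < (1 - ε) * n / 2}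
  let U : Finset (ι → ZMod 2) := A - (W : Set (ι → ZMod 2)).toFinset
  let B : Finset (ι → ZMod 2) := {φ | (1 + δ) * Fintype.card κ / 2 < (hammingNorm (T φ) : ℝ)}
  have hU : 2 * (#U : ℝ) < 2 ^ n := by
    calc 2 * (#U : ℝ) ≤ 2 * (#A * 2 ^ finrank (ZMod 2) W) := by
          gcongr
          exact_mod_cast card_sub_submodule_le A W
      _ ≤ 2 * (2 ^ n * Real.exp (-(ε ^ 2 * n / 2)) * 2 ^ finrank (ZMod 2) W) := by
          gcongr
          exact card_hammingNorm_lt_le hε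
      _ = 2 * 2 ^ n * (2 ^ finrank (ZMod 2) W * Real.exp (-(ε ^ 2 * n / 2))) := by ring
      _ < 2 * 2 ^ n * (1 / 2) := by gcongr
      _ = 2 ^ n := by ring
  have hB : 2 * (#B : ℝ) ≤ 2 ^ n := by
    simpa [h_card] using two_mul_card_lt_hammingNorm_le hT hδ hκ
  have h_lt : #(U ∪ B) < #(univ : Finset (ι → ZMod 2)) := by
    have h_union : (#(U ∪ B) : ℝ) ≤ #U + #B := by exact_mod_cast card_union_le U B
    have h_real : (#(U ∪ B) : ℝ) < 2 ^ n := by linarith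
    rw [card_univ, h_card]
    exact_mod_cast h_real
  obtain ⟨φ, -, hφ⟩ := exists_mem_notMem_of_card_lt_card h_lt
  rw [mem_union, not_or] at hφ
  refine ⟨φ, not_lt.1 fun h ↦ hφ.2 ((mem_filter_univ φ).2 h),
    fun w hw ↦ not_lt.1 fun h ↦ hφ.1 ?_⟩
  exact mem_sub.2 ⟨φ + w, (mem_filter_univ _).2 h, w, Set.mem_toFinset.2 hw,
    add_sub_cancel_right φ w⟩

end RandomVectors

variable {V : Type*} {F : Set (Finset V)} {k m D : ℕ}

section Faces

/-- A simplicial complex in either convention: the family is closed under passing to nonempty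
subsets, and it may or may not contain the empty simplex. -/
def IsComplex (F : Set (Finset V)) : Prop :=
  ∀ ⦃t⦄, t ∈ F → ∀ ⦃s⦄, s ⊆ t → s.Nonempty → s ∈ F

lemma isComplex_faces (X : PreAbstractSimplicialComplex V) : IsComplex X.faces :=
  fun _ ht _ hst hs ↦ (X.isRelLowerSet_faces ht).2 hst hs

lemma IsComplex.insert_empty (hF : IsComplex F) : IsComplex (insert ∅ F) :=
  fun _ ht _ hst hs ↦ Or.inr <| hF (ht.resolve_left (hs.mono hst).ne_empty) hst hs

lemma IsPure.exists_mem_faces_card_eq {X : PreAbstractSimplicialComplex V}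
    (hX : IsPure X m) (hk : k ≤ m) : ∃ s ∈ X.faces, #s = k + 1 := by
  obtain ⟨⟨s, hs⟩, -, h_ext⟩ := hX
  obtain ⟨t, ht, -, ht_card⟩ := h_ext s hs
  obtain ⟨u, hut, hu_card⟩ := exists_subset_card_eq (s := t) (n := k + 1) (by omega)
  exact ⟨u, isComplex_faces X ht hut (card_pos.1 (by omega)), hu_card⟩

end Faces

variable [Fintype V]

section Cochains

lemma mem_cells {s : Finset V} : s ∈ cells F m ↔ s ∈ F ∧ #s = m := by
  simp [cells]

lemma cnorm_eq_hammingNorm (φ : Cochain F m) : cnorm φ = hammingNorm φ := by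
  rw [cnorm, hammingNorm, ← Set.ncard_coe_finset]
  congr 1
  ext
  simp

lemma exists_cnorm_add_coboundary_eq_csyNorm (φ : Cochain F (k + 1)) :
    ∃ ψ, cnorm (φ + coboundary F k ψ) = csyNorm φ :=
  ciInf_mem fun ψ ↦ cnorm (φ + coboundary F k ψ)

lemma csyNorm_eq_zero_of_mem_range {φ : Cochain F (k + 1)}
    (hφ : φ ∈ LinearMap.range (coboundary F k)) : csyNorm φ = 0 := by
  obtain ⟨ψ, rfl⟩ := hφ
  refine Nat.le_zero.1 ((ciInf_le (OrderBot.bddBelow _) (-ψ)).trans_eq ?_)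
  simp [cnorm]

lemma expansions_nonempty_and_sInf_le {φ : Cochain F (k + 1)} {a b : ℝ} (ha : 0 < a)
    (hb : (cnorm (coboundary F (k + 1) φ) : ℝ) ≤ b) (hφ : a ≤ csyNorm φ) :
    (expansions F k).Nonempty ∧ sInf (expansions F k) ≤ b / a := by
  have h_not_mem : φ ∉ LinearMap.range (coboundary F k) := fun h ↦ by
    rw [csyNorm_eq_zero_of_mem_range h, Nat.cast_zero] at hφ
    exact hφ.not_gt ha
  have h_bdd : BddBelow (expansions F k) := ⟨0, by rintro _ ⟨φ, -, rfl⟩; positivity⟩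
  refine ⟨⟨_, φ, h_not_mem, rfl⟩, (csInf_le h_bdd ⟨φ, h_not_mem, rfl⟩).trans ?_⟩
  exact div_le_div₀ ((Nat.cast_nonneg _).trans hb) hb ha hφ

open Classical in
lemma coboundary_single (σ : cells F m) (τ : cells F (m + 1)) :
    coboundary F m (Pi.single σ 1) τ = if σ.1 ⊆ τ.1 then 1 else 0 := by
  simp [coboundary, Pi.single_apply]

open Classical in
lemma finrank_range_coboundary_le :
    finrank (ZMod 2) (LinearMap.range (coboundary F m)) ≤ #(∂ (cells F (m + 1))) := by
  let χ (s : Finset V) : Cochain F (m + 1) := fun τ ↦ if s ⊆ τ.1 then 1 else 0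
  have h_range : LinearMap.range (coboundary F m) ≤
      Submodule.span (ZMod 2) ((∂ (cells F (m + 1))).image χ : Set (Cochain F (m + 1))) := by
    rintro _ ⟨φ, rfl⟩
    have h_sum : coboundary F m φ = ∑ σ, φ σ • χ σ.1 := by
      ext τ
      simp [coboundary, χ, sum_filter]
    rw [h_sum]
    refine Submodule.sum_mem _ fun σ _ ↦ Submodule.smul_mem _ _ ?_
    by_cases hσ : σ.1 ∈ ∂ (cells F (m + 1))
    · exact Submodule.subset_span (mem_coe.2 (mem_image_of_mem χ hσ))
    · have h_zero : χ σ.1 = 0 := funext fun τ ↦ if_neg fun hστ ↦ hσ <|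
        mem_shadow_iff_exists_mem_card_add_one.2
          ⟨τ, τ.2, hστ, by rw [(mem_cells.1 τ.2).2, (mem_cells.1 σ.2).2]⟩
      exact h_zero ▸ Submodule.zero_mem _
  exact (Submodule.finrank_mono h_range).trans
    ((finrank_span_finset_le_card _).trans card_image_le)

end Cochains

section Complexes

open Classical in
/-- The degree of a set `s` in the family `F`; for the faces of a complex `X` this is `degree X`,
but it also makes sense for the family augmented by the empty simplex. -/
noncomputable def upDegree (F : Set (Finset V)) (s : Finset V) : ℕ :=
  #{t ∈ cells F (#s + 1) | s ⊆ t}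

lemma IsComplex.antitone_upDegree (hF : IsComplex F) : Antitone (upDegree F) := by
  classical
  intro s u hsu
  refine card_le_card_of_injOn (fun t ↦ s ∪ t \ u) (fun t ht ↦ ?_) fun t ht t' ht' h ↦ ?_
  · obtain ⟨ht, hut⟩ := mem_filter.1 ht
    obtain ⟨htF, ht_card⟩ := mem_cells.1 ht
    have h_card : #(s ∪ t \ u) = #s + 1 := by
      rw [card_union_of_disjoint (disjoint_sdiff.mono_left hsu), card_sdiff_of_subset hut, ht_card,
        Nat.add_sub_cancel_left]
    exact mem_filter.2 ⟨mem_cells.2 ⟨hF htF (union_subset (hsu.trans hut) sdiff_subset)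
      (card_pos.1 (h_card ▸ Nat.succ_pos _)), h_card⟩, subset_union_left⟩
  · have h_union : u ∪ (s ∪ t \ u) = u ∪ (s ∪ t' \ u) := congrArg (u ∪ ·) h
    rwa [← union_assoc, ← union_assoc, union_eq_left.2 hsu,
      union_sdiff_of_subset (mem_filter.1 ht).2, union_sdiff_of_subset (mem_filter.1 ht').2]
      at h_union

lemma IsComplex.card_cells_mul_eq (hF : IsComplex F)
    (hdeg : ∀ s ∈ cells F (k + 1), upDegree F s = D) :
    #(cells F (k + 1)) * D = #(cells F (k + 2)) * (k + 2) := by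
  classical
  refine card_mul_eq_card_mul (· ⊆ ·) (fun s hs ↦ ?_) fun t ht ↦ ?_
  · rw [← hdeg s hs, upDegree, (mem_cells.1 hs).2, bipartiteAbove]
  · obtain ⟨htF, ht_card⟩ := mem_cells.1 ht
    have h_facets : (cells F (k + 1)).bipartiteBelow (· ⊆ ·) t = t.powersetCard (k + 1) := by
      ext s
      rw [mem_bipartiteBelow, mem_cells, mem_powersetCard]
      exact ⟨fun h ↦ ⟨h.2, h.1.2⟩,
        fun h ↦ ⟨⟨hF htF h.1 (card_pos.1 (by omega)), h.2⟩, h.1⟩⟩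
    rw [h_facets, card_powersetCard, ht_card, Nat.choose_succ_self_right]

lemma IsComplex.le_upDegree_of_subset (hF : IsComplex F)
    (hdeg : ∀ u ∈ cells F m, D ≤ upDegree F u) {s u : Finset V} (hsu : s ⊆ u)
    (hu : u ∈ cells F m) : D ≤ upDegree F s :=
  (hdeg u hu).trans (hF.antitone_upDegree hsu)

open Classical in
lemma IsComplex.card_shadow_cells_mul_le (hF : IsComplex F)
    (hdeg : ∀ u ∈ cells F (k + 1), D ≤ upDegree F u) :
    #(∂ (cells F (k + 1))) * D ≤ #(cells F (k + 1)) * (k + 1) := by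
  refine card_mul_le_card_mul (· ⊆ ·) (fun s hs ↦ ?_) fun u hu ↦ ?_
  · obtain ⟨u, hu, hsu, hu_card⟩ := mem_shadow_iff_exists_mem_card_add_one.1 hs
    have hs_card : #s + 1 = k + 1 := hu_card.symm.trans (mem_cells.1 hu).2
    rw [bipartiteAbove, ← hs_card]
    exact hF.le_upDegree_of_subset hdeg hsu hu
  · have h_facets : (∂ (cells F (k + 1))).bipartiteBelow (· ⊆ ·) u ⊆ u.powersetCard k := by
      intro s hs
      obtain ⟨hs, hsu⟩ := mem_bipartiteBelow _ |>.1 hs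
      obtain ⟨t, ht, -, ht_card⟩ := mem_shadow_iff_exists_mem_card_add_one.1 hs
      exact mem_powersetCard.2 ⟨hsu, Nat.succ_injective (ht_card.symm.trans (mem_cells.1 ht).2)⟩
    refine (card_le_card h_facets).trans_eq ?_
    rw [card_powersetCard, (mem_cells.1 hu).2, Nat.choose_succ_self_right]

lemma IsComplex.le_card_cells (hF : IsComplex F) (hne : (cells F (k + 1)).Nonempty)
    (hdeg : ∀ u ∈ cells F (k + 1), D ≤ upDegree F u) : D ≤ #(cells F (k + 1)) := by
  classical
  obtain ⟨u, hu⟩ := hne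
  obtain ⟨s, hsu, rfl⟩ := exists_subset_card_eq (s := u) (n := k)
    (by rw [(mem_cells.1 hu).2]; exact k.le_succ)
  exact (hF.le_upDegree_of_subset hdeg hsu hu).trans (card_filter_le _ _)

lemma IsComplex.pairwise_exists_coboundary_ne (hF : IsComplex F) :
    Pairwise fun τ τ' ↦ ∃ φ, coboundary F (k + 1) φ τ ≠ coboundary F (k + 1) φ τ' := by
  classical
  intro τ τ' hne
  obtain ⟨hτF, hτ_card⟩ := mem_cells.1 τ.2
  have h_not_subset : ¬ τ.1 ⊆ τ'.1 := fun h ↦ hne <| Subtype.ext <|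
    eq_of_subset_of_card_le h (by rw [hτ_card, (mem_cells.1 τ'.2).2])
  obtain ⟨v, hv, hv'⟩ := not_subset.1 h_not_subset
  obtain ⟨σ, hvσ, hστ, hσ_card⟩ := exists_subsuperset_card_eq
    (singleton_subset_iff.2 hv) (n := k + 1) (by simp) (by omega)
  have hvσ : v ∈ σ := singleton_subset_iff.1 hvσ
  have hσ : σ ∈ cells F (k + 1) := mem_cells.2 ⟨hF hτF hστ ⟨v, hvσ⟩, hσ_card⟩
  refine ⟨Pi.single ⟨σ, hσ⟩ 1, ?_⟩
  rw [coboundary_single, coboundary_single, if_pos hστ, if_neg fun h ↦ hv' (h hvσ)]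
  exact one_ne_zero

end Complexes

section CheegerBound

lemma two_pow_mul_exp_neg_two_mul_lt_half {r : ℕ} {x : ℝ} (hr : r ≤ x) (hx : 1 ≤ x) :
    2 ^ r * Real.exp (-(2 * x)) < 1 / 2 := by
  have h_two : (2 : ℝ) ≤ Real.exp 1 := by linarith [Real.add_one_le_exp 1]
  calc 2 ^ r * Real.exp (-(2 * x)) ≤ Real.exp 1 ^ r * Real.exp (-(2 * x)) := by gcongr
    _ = Real.exp (r - 2 * x) := by rw [← Real.exp_nat_mul, ← Real.exp_add]; ring_nf
    _ ≤ Real.exp (-1) := Real.exp_le_exp.2 (by linarith)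
    _ < 1 / 2 := Real.exp_neg_one_lt_half

lemma IsComplex.finrank_range_coboundary_le_sq_mul (hF : IsComplex F)
    (hdeg : ∀ u ∈ cells F (k + 1), D ≤ upDegree F u) {s : ℝ} (hsD : s ^ 2 * D = k + 1) :
    (finrank (ZMod 2) (LinearMap.range (coboundary F k)) : ℝ) ≤ s ^ 2 * #(cells F (k + 1)) := by
  classical
  have hD : (0 : ℝ) < D := pos_of_mul_pos_right (hsD ▸ k.cast_add_one_pos) (sq_nonneg s)
  refine (Nat.cast_le.2 finrank_range_coboundary_le).trans (le_of_mul_le_mul_right ?_ hD)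
  calc (#(∂ (cells F (k + 1))) : ℝ) * D ≤ #(cells F (k + 1)) * (k + 1) := by
        exact_mod_cast hF.card_shadow_cells_mul_le hdeg
    _ = s ^ 2 * #(cells F (k + 1)) * D := by rw [← hsD]; ring

lemma IsComplex.half_le_sq_mul_card_cells (hF : IsComplex F) (hne : (cells F (k + 1)).Nonempty)
    (hdeg : ∀ u ∈ cells F (k + 1), upDegree F u = D) {s : ℝ} (hsD : s ^ 2 * D = k + 1) :
    1 / 2 ≤ s ^ 2 * #(cells F (k + 2)) := by
  have h_count : (#(cells F (k + 1)) : ℝ) * D = #(cells F (k + 2)) * (k + 2) := by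
    exact_mod_cast hF.card_cells_mul_eq hdeg
  have h_one_le : (1 : ℝ) ≤ #(cells F (k + 1)) := Nat.one_le_cast.2 hne.card_pos
  refine le_of_mul_le_mul_right ?_ (by positivity : (0 : ℝ) < k + 2)
  calc 1 / 2 * (k + 2 : ℝ) ≤ 1 * (k + 1) := by linarith [k.cast_nonneg (α := ℝ)]
    _ ≤ #(cells F (k + 1)) * (k + 1) := by gcongr
    _ = s ^ 2 * #(cells F (k + 2)) * (k + 2) := by
      rw [mul_assoc, ← h_count, ← hsD]
      ring

lemma IsComplex.exists_cnorm_coboundary_le_and_le_csyNorm (hF : IsComplex F)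
    (hne : (cells F (k + 1)).Nonempty) (hdeg : ∀ u ∈ cells F (k + 1), upDegree F u = D) {s : ℝ}
    (hs : 0 ≤ s) (hsD : s ^ 2 * D = k + 1) :
    ∃ φ : Cochain F (k + 1),
      (cnorm (coboundary F (k + 1) φ) : ℝ) ≤ (1 + 2 * s) * #(cells F (k + 2)) / 2 ∧
      (1 - 2 * s) * #(cells F (k + 1)) / 2 ≤ csyNorm φ := by
  have hdeg_le (u) (hu : u ∈ cells F (k + 1)) : D ≤ upDegree F u := (hdeg u hu).ge
  have h_one_le : 1 ≤ s ^ 2 * #(cells F (k + 1)) := by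
    calc (1 : ℝ) ≤ k + 1 := by linarith [k.cast_nonneg (α := ℝ)]
      _ = s ^ 2 * D := hsD.symm
      _ ≤ s ^ 2 * #(cells F (k + 1)) := by
        gcongr
        exact hF.le_card_cells hne hdeg_le
  have h_rank : 2 ^ finrank (ZMod 2) (LinearMap.range (coboundary F k)) *
      Real.exp (-((2 * s) ^ 2 * Fintype.card (cells F (k + 1)) / 2)) < 1 / 2 := by
    convert two_pow_mul_exp_neg_two_mul_lt_half
      (hF.finrank_range_coboundary_le_sq_mul hdeg_le hsD) h_one_le using 3
    rw [Fintype.card_coe]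
    ring
  have h_top : 2 ≤ (2 * s) ^ 2 * Fintype.card (cells F (k + 2)) := by
    rw [Fintype.card_coe]
    linarith [hF.half_le_sq_mul_card_cells hne hdeg hsD]
  obtain ⟨φ, h_coboundary, h_dist⟩ := exists_hammingNorm_le_and_forall_le_hammingNorm_add
    (LinearMap.range (coboundary F k)) (T := (coboundary F (k + 1)).toAddMonoidHom)
    hF.pairwise_exists_coboundary_ne (by positivity) (by positivity) h_rank h_top
  obtain ⟨ψ, hψ⟩ := exists_cnorm_add_coboundary_eq_csyNorm φ
  rw [Fintype.card_coe] at h_coboundary h_dist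
  refine ⟨φ, by rwa [cnorm_eq_hammingNorm], ?_⟩
  rw [← hψ, cnorm_eq_hammingNorm]
  exact h_dist _ (LinearMap.mem_range_self _ ψ)

lemma IsComplex.expansions_nonempty_and_sInf_le_of_regular (hF : IsComplex F)
    (hne : (cells F (k + 1)).Nonempty) (hdeg : ∀ u ∈ cells F (k + 1), upDegree F u = D)
    (hD : 5 * (k + 1) ≤ D) :
    (expansions F k).Nonempty ∧ sInf (expansions F k) ≤
      (1 + 50 * √((k : ℝ) + 1) / √(D : ℝ)) * ((D : ℝ) / ((k : ℝ) + 2)) := by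
  have hD_real : (5 : ℝ) * (k + 1) ≤ D := by exact_mod_cast hD
  have hk : (0 : ℝ) < k + 1 := k.cast_add_one_pos
  have hD_pos : (0 : ℝ) < D := by linarith
  obtain ⟨s, hs⟩ : ∃ s : ℝ, s = √((k : ℝ) + 1) / √(D : ℝ) := ⟨_, rfl⟩
  have hs0 : 0 ≤ s := hs ▸ by positivity
  have hsD : s ^ 2 * D = k + 1 := by
    rw [hs, div_pow, Real.sq_sqrt hk.le, Real.sq_sqrt hD_pos.le, div_mul_cancel₀ _ hD_pos.ne']
  have hs_le : s ≤ 0.45 := by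
    have h_sq : s ^ 2 ≤ 1 / 5 := le_of_mul_le_mul_right (by linarith) hD_pos
    exact le_of_sq_le_sq (h_sq.trans (by norm_num)) (by norm_num)
  obtain ⟨φ, h_coboundary, h_csy⟩ :=
    hF.exists_cnorm_coboundary_le_and_le_csyNorm hne hdeg hs0 hsD
  have hn : (0 : ℝ) < #(cells F (k + 1)) := Nat.cast_pos.2 hne.card_pos
  have h_pos : 0 < (1 - 2 * s) * #(cells F (k + 1)) / 2 :=
    div_pos (mul_pos (by linarith) hn) two_pos
  have h_count : (#(cells F (k + 2)) : ℝ) = #(cells F (k + 1)) * (D / (k + 2)) := by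
    have : (#(cells F (k + 1)) : ℝ) * D = #(cells F (k + 2)) * (k + 2) := by
      exact_mod_cast hF.card_cells_mul_eq hdeg
    field_simp
    linarith
  obtain ⟨h_nonempty, h_le⟩ := expansions_nonempty_and_sInf_le h_pos h_coboundary h_csy
  refine ⟨h_nonempty, h_le.trans ?_⟩
  rw [mul_div_assoc 50, ← hs, div_le_iff₀ h_pos, h_count]
  calc (1 + 2 * s) * (#(cells F (k + 1)) * (D / (k + 2))) / 2
      ≤ (1 + 50 * s) * (1 - 2 * s) * (#(cells F (k + 1)) * (D / (k + 2))) / 2 := by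
        gcongr
        nlinarith
    _ = (1 + 50 * s) * (D / (k + 2)) * ((1 - 2 * s) * #(cells F (k + 1)) / 2) := by ring

end CheegerBound

section Conventions

lemma cells_insert_empty : cells (insert ∅ F) (m + 1) = cells F (m + 1) := by
  ext s
  rw [mem_cells, mem_cells, Set.mem_insert_iff, and_congr_left_iff]
  exact fun hs ↦ or_iff_right (card_pos.1 (hs ▸ m.succ_pos)).ne_empty

lemma upDegree_insert_empty (s : Finset V) : upDegree (insert ∅ F) s = upDegree F s := by
  rw [upDegree, cells_insert_empty, upDegree]

lemma upDegree_faces (X : PreAbstractSimplicialComplex V) (s : Finset V) :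
    upDegree X.faces s = degree X s := by
  rw [upDegree, degree, ← Set.ncard_coe_finset]
  congr 1
  ext t
  simp only [coe_filter, mem_cells, Set.mem_ofPred_eq, and_left_comm, and_comm]

end Conventions

end CoboundaryExpansion

open CoboundaryExpansion in
theorem theoremt_general {V : Type*} [Fintype V] (X : PreAbstractSimplicialComplex V) (k D : ℕ)
    (hne : ∃ s ∈ X.faces, s.card = k + 1)
    (hdeg : ∀ s ∈ X.faces, s.card = k + 1 → degree X s = D)
    (hD : 5 * (k + 1) ≤ D) :
    ((expansions X.faces k).Nonempty ∧
      cheeger X k ≤ (1 + 50 * √((k : ℝ) + 1) / √(D : ℝ)) * ((D : ℝ) / ((k : ℝ) + 2))) ∧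
    ((expansions (insert ∅ X.faces) k).Nonempty ∧
      reducedCheeger X k ≤
        (1 + 50 * √((k : ℝ) + 1) / √(D : ℝ)) * ((D : ℝ) / ((k : ℝ) + 2))) := by
  have h_complex := isComplex_faces X
  have h_nonempty : (cells X.faces (k + 1)).Nonempty := hne.imp fun _ ↦ mem_cells.2
  have h_regular (s) (hs : s ∈ cells X.faces (k + 1)) : upDegree X.faces s = D :=
    (upDegree_faces X s).trans (hdeg s (mem_cells.1 hs).1 (mem_cells.1 hs).2)
  refine ⟨h_complex.expansions_nonempty_and_sInf_le_of_regular h_nonempty h_regular hD,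
    h_complex.insert_empty.expansions_nonempty_and_sInf_le_of_regular ?_ ?_ hD⟩
  · rwa [cells_insert_empty]
  · simpa only [cells_insert_empty, upDegree_insert_empty] using h_regular

theorem theoremt {V : Type*} [Fintype V] (X : PreAbstractSimplicialComplex V) (k D : ℕ)
    (hpure : CoboundaryExpansion.IsPure X (k + 1))
    (hdeg : ∀ s ∈ X.faces, s.card = k + 1 → CoboundaryExpansion.degree X s = D)
    (hD : 40 ^ 2 * (k + 1) ≤ D) :
    ((CoboundaryExpansion.expansions X.faces k).Nonempty ∧
      CoboundaryExpansion.cheeger X k ≤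
        (1 + 50 * √((k : ℝ) + 1) / √(D : ℝ)) * ((D : ℝ) / ((k : ℝ) + 2))) ∧
    ((CoboundaryExpansion.expansions (insert ∅ X.faces) k).Nonempty ∧
      CoboundaryExpansion.reducedCheeger X k ≤
        (1 + 50 * √((k : ℝ) + 1) / √(D : ℝ)) * ((D : ℝ) / ((k : ℝ) + 2))) :=
  theoremt_general X k D (hpure.exists_mem_faces_card_eq k.le_succ) hdeg (by omega)
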